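/- Let $(s_n)_{n\ge 0}$ be a sequence of real numbers and let $s\in\mathbb R$. Write $s_n\to s\ (\ell)$ if $$\frac{1}{\log n}\sum_{i=0}^{n}\frac{s_i}{i+1}\longrightarrow s\qquad(n\to\infty),$$ and write $s_n\to s\ (L)$ if the power series $\sum_{i\ge 0}\frac{s_i}{i+1}x^{i+1}$ converges for $0<x<1$ and $$\frac{1}{-\log(1-x)}\sum_{i=0}^{\infty}\frac{s_i}{i+1}x^{i+1}\longrightarrow s\qquad(x\uparrow 1).$$ If $s_n\to s\ (\ell)$, then $s_n\to s\ (L)$. Moreover, if $(s_n)$ is summable to $s$ by at least one of the two methods, then the equivalence $$s_n\to s\ (\ell)\iff s_n\to s\ (L)$$ holds if and only if $$\lim_{\lambda\downarrow 1}\ \liminf_{n\to\infty}\ \min_{n\le m\le \lambda n}\ \frac{1}{\log n}\sum_{n\le i\le m}\frac{s_i}{i+1}\ \ge\ 0,$$ where $m$ ranges over integers, and the lower limit and the limit are taken in $[-\infty,\infty]$. -/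

import Mathlib

open Filter Topology

/-- `s_n → σ` by the logarithmic method `ℓ`:
`(1 / log n) * ∑_{i=0}^{n} s_i / (i+1) → σ` as `n → ∞`. -/
def SummableEll (s : ℕ → ℝ) (σ : ℝ) : Prop :=
  Tendsto (fun n : ℕ => 1 / Real.log (n : ℝ) *
    ∑ i ∈ Finset.range (n + 1), s i / ((i : ℝ) + 1)) atTop (𝓝 σ)

/-- `s_n → σ` by the logarithmic method `L`: the power series `∑ s_i x^(i+1) / (i+1)` converges
for `0 < x < 1`, and `(1 / (-log (1-x))) * ∑_{i=0}^{∞} s_i x^(i+1) / (i+1) → σ` as `x ↑ 1`.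
(A power series that converges at all points of `(0,1)` converges absolutely there.) -/
def SummableL (s : ℕ → ℝ) (σ : ℝ) : Prop :=
  (∀ x ∈ Set.Ioo (0 : ℝ) 1, Summable fun i : ℕ => s i / ((i : ℝ) + 1) * x ^ (i + 1)) ∧
  Tendsto (fun x : ℝ => 1 / (-Real.log (1 - x)) *
    ∑' i : ℕ, s i / ((i : ℝ) + 1) * x ^ (i + 1)) (𝓝[<] 1) (𝓝 σ)

/-- `min_{n ≤ m ≤ lam * n} (1 / log n) * ∑_{n ≤ i ≤ m} s_i / (i+1)`, as an extended real.
For `lam ≥ 1` the set of indices `m` is finite and contains `n`, so the infimum is a minimum. -/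
noncomputable def minLogBlock (s : ℕ → ℝ) (lam : ℝ) (n : ℕ) : EReal :=
  ⨅ m ∈ {m : ℕ | n ≤ m ∧ (m : ℝ) ≤ lam * (n : ℝ)},
    ((1 / Real.log (n : ℝ) * ∑ i ∈ Finset.Icc n m, s i / ((i : ℝ) + 1) : ℝ) : EReal)

/-- `lim_{lam ↓ 1} liminf_{n → ∞} min_{n ≤ m ≤ lam * n} (1 / log n) * ∑_{n ≤ i ≤ m} s_i / (i+1) ≥ 0`,
where the inner lower limit and the outer limit are taken in the extended reals. -/
def OneSidedLogCondition (s : ℕ → ℝ) : Prop :=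
  ∃ l : EReal, Tendsto (fun lam : ℝ => liminf (fun n : ℕ => minLogBlock s lam n) atTop)
    (𝓝[>] 1) (𝓝 l) ∧ 0 ≤ l

/-! Since `∑_{i<n} 1/(i+1) = log n + O(1)` and `∑ x^(i+1)/(i+1) = -log (1-x)`, subtracting `σ` from
`s` reduces both methods to limit `0`. With `b = centredTerm s σ` and `A = stepSum b`, `ℓ` says `A =
o(log)`, and `L` says that the power series of `b` is `o(-log (1-x))`. The two are linked by `∑ b_i
e^(-h(i+1)) = h ∫ e^(-ht) A(t) dt` (`laplace_stepSum`).

Abelian half: partial sums dominated by `C + ε H_n`, with `H_n` the harmonic sums, give a power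
series dominated by `C - ε log (1-x)`.

Tauberian half (`isLittleO_log_of_laplace`): `L` makes the means `∫ e^(-kv) A(uv) dv` equal to
`o(log u)` for `k = 1, 2, ...`, and the one-sided condition makes `A` slowly decreasing on the scale
of `log`. Karamata's method replaces `e^(-kv)` by `e^(-v) g(e^(-v))` with `g` continuous; a bump
near `v = 1` and slow decrease then recover `A(u)`. The approximation needs a two-sided bound `A(uv)
= O(log u)` with an integrable weight in `v`, which the one-sided hypothesis does not supply
directly. It comes from the mean-zero kernel `e^(-v) - 2e^(-2v)`, which changes sign once
(`exists_upper_oscillation_bound`, `exists_log_bound`).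

Conversely `ℓ` makes every block sum over `[n, lam n]` equal to `o(log n)`, so the condition holds
with limit `0`. -/

open MeasureTheory Set Asymptotics

/-! ### Laplace transforms of step functions -/

/-- The step function `t ↦ ∑_{i < ⌊t⌋₊} a i`, whose Laplace–Stieltjes transform is
`h ↦ ∑ a i * exp (-h) ^ (i + 1)`. -/
noncomputable def stepSum (a : ℕ → ℝ) (t : ℝ) : ℝ := ∑ i ∈ Finset.range ⌊t⌋₊, a i

theorem measurable_stepSum (a : ℕ → ℝ) : Measurable (stepSum a) :=
  (measurable_from_nat (f := fun n => ∑ i ∈ Finset.range n, a i)).comp Nat.measurable_floor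

theorem hasSum_stepSum_laplace (a : ℕ → ℝ) (h t : ℝ) :
    HasSum (fun i : ℕ => (Ici ((i : ℝ) + 1)).indicator (fun t => a i * Real.exp (-h * t)) t)
      (Real.exp (-h * t) * stepSum a t) := by
  have key : Real.exp (-h * t) * stepSum a t = ∑ i ∈ Finset.range ⌊t⌋₊,
      (Ici ((i : ℝ) + 1)).indicator (fun t => a i * Real.exp (-h * t)) t := by
    rw [stepSum, Finset.mul_sum]
    refine Finset.sum_congr rfl fun i hi => ?_
    rw [indicator_of_mem, mul_comm]
    have h1 : i + 1 ≤ ⌊t⌋₊ := Finset.mem_range.1 hi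
    have := (Nat.le_floor_iff' (by omega)).1 h1
    simpa using this
  rw [key]
  refine hasSum_sum_of_ne_finset_zero fun i hi => indicator_of_notMem (fun hm => hi ?_) _
  have : ((i + 1 : ℕ) : ℝ) ≤ t := by simpa using hm
  exact Finset.mem_range.2 ((Nat.le_floor_iff' (by omega)).2 this)

/-- Summation by parts as an integral: `e^(-h(i+1)) = h ∫_{i+1}^∞ e^(-ht) dt`. Summability in `ℝ` is
absolute, which justifies integrating term by term. -/
theorem laplace_stepSum {a : ℕ → ℝ} {h : ℝ} (hh : 0 < h)
    (hs : Summable fun i : ℕ => a i * Real.exp (-h) ^ (i + 1)) :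
    IntegrableOn (fun t => Real.exp (-h * t) * stepSum a t) (Ioi 0) ∧
    ∫ t in Ioi 0, Real.exp (-h * t) * stepSum a t =
      1 / h * ∑' i : ℕ, a i * Real.exp (-h) ^ (i + 1) := by
  set F : ℕ → ℝ → ℝ := fun i => (Ici ((i : ℝ) + 1)).indicator (fun t => a i * Real.exp (-h * t))
    with hF
  have hpow : ∀ i : ℕ, Real.exp (-h * ((i : ℝ) + 1)) = Real.exp (-h) ^ (i + 1) := by
    intro i
    rw [← Real.exp_nat_mul]; congr 1; push_cast; ring
  have hsub : ∀ i : ℕ, Ici ((i : ℝ) + 1) ∩ Ioi 0 = Ici ((i : ℝ) + 1) := by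
    intro i
    refine inter_eq_left.2 fun t ht => ?_
    have : (i : ℝ) + 1 ≤ t := ht
    have : (0 : ℝ) ≤ i := i.cast_nonneg
    show 0 < t
    linarith
  have hint : ∀ i, Integrable (F i) (volume.restrict (Ioi 0)) := by
    intro i
    rw [hF, integrable_indicator_iff measurableSet_Ici, IntegrableOn,
      Measure.restrict_restrict measurableSet_Ici, hsub]
    exact ((integrableOn_Ici_iff_integrableOn_Ioi).2
      (integrableOn_exp_mul_Ioi (neg_lt_zero.2 hh) _)).const_mul _
  have hval : ∀ (c : ℝ) (i : ℕ), ∫ t in Ioi 0, (Ici ((i : ℝ) + 1)).indicator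
      (fun t => c * Real.exp (-h * t)) t = 1 / h * (c * Real.exp (-h) ^ (i + 1)) := by
    intro c i
    rw [integral_indicator measurableSet_Ici, Measure.restrict_restrict measurableSet_Ici, hsub,
      integral_Ici_eq_integral_Ioi, integral_const_mul, integral_exp_mul_Ioi (neg_lt_zero.2 hh),
      hpow]
    field_simp
  have hnorm : ∀ i, ∫ t in Ioi 0, ‖F i t‖ = 1 / h * |a i * Real.exp (-h) ^ (i + 1)| := by
    intro i
    rw [abs_mul, abs_of_pos (pow_pos (Real.exp_pos _) _), ← hval |a i| i]
    refine integral_congr_ae (Eventually.of_forall fun t => ?_)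
    simp only [hF, norm_indicator_eq_indicator_norm, norm_mul, Real.norm_eq_abs, Real.abs_exp]
  have hsum : Summable fun i => ∫ t in Ioi 0, ‖F i t‖ := by
    simp_rw [hnorm]
    exact hs.abs.mul_left _
  have htsum : (fun t => Real.exp (-h * t) * stepSum a t) = fun t => ∑' i, F i t :=
    funext fun t => (hasSum_stepSum_laplace a h t).tsum_eq.symm
  constructor
  · refine ⟨?_, ?_⟩
    · exact ((by fun_prop : Measurable fun t : ℝ => Real.exp (-h * t)).mul
        (measurable_stepSum a)).aestronglyMeasurable
    · rw [htsum, HasFiniteIntegral]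
      calc ∫⁻ t in Ioi 0, ‖∑' i, F i t‖ₑ ≤ ∫⁻ t in Ioi 0, ∑' i, ‖F i t‖ₑ :=
            lintegral_mono fun t => enorm_tsum_le_tsum_enorm
        _ = ∑' i, ∫⁻ t in Ioi 0, ‖F i t‖ₑ :=
            lintegral_tsum fun i => (hint i).1.enorm
        _ < ⊤ := by
            have : ∀ i, ∫⁻ t in Ioi 0, ‖F i t‖ₑ = ENNReal.ofReal (∫ t in Ioi 0, ‖F i t‖) :=
              fun i => (ofReal_integral_norm_eq_lintegral_enorm (hint i)).symm
            simp_rw [this]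
            exact hsum.tsum_ofReal_lt_top
  · rw [htsum, ← integral_tsum_of_summable_integral_norm hint hsum, ← tsum_mul_left]
    exact tsum_congr fun i => hval (a i) i

theorem laplace_stepSum_scaled {a : ℕ → ℝ}
    (hs : ∀ x ∈ Ioo (0 : ℝ) 1, Summable fun i : ℕ => a i * x ^ (i + 1))
    {k u : ℝ} (hk : 0 < k) (hu : 0 < u) :
    IntegrableOn (fun v => Real.exp (-k * v) * stepSum a (u * v)) (Ioi 0) ∧
    ∫ v in Ioi 0, Real.exp (-k * v) * stepSum a (u * v) =
      1 / k * ∑' i : ℕ, a i * Real.exp (-(k / u)) ^ (i + 1) := by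
  have hku : 0 < k / u := div_pos hk hu
  obtain ⟨h1, h2⟩ := laplace_stepSum hku
    (hs _ ⟨Real.exp_pos _, by rw [Real.exp_lt_one_iff]; linarith⟩)
  let g : ℝ → ℝ := fun t => Real.exp (-(k / u) * t) * stepSum a t
  have hfun : (fun v => Real.exp (-k * v) * stepSum a (u * v)) = fun v => g (u * v) := by
    funext v
    have : -(k / u) * (u * v) = -k * v := by field_simp
    simp only [g, this]
  constructor
  · rw [hfun, integrableOn_Ioi_comp_mul_left_iff g _ hu, mul_zero]
    exact h1
  · rw [hfun, integral_comp_mul_left_Ioi g _ hu, mul_zero, h2, smul_eq_mul]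
    field_simp

/-! ### The Abelian direction -/

theorem tendsto_neg_log_one_sub : Tendsto (fun x : ℝ => -Real.log (1 - x)) (𝓝[<] 1) atTop := by
  refine tendsto_neg_atBot_atTop.comp (Real.tendsto_log_nhdsGT_zero.comp ?_)
  refine tendsto_nhdsWithin_iff.2 ⟨?_, ?_⟩
  · have : Tendsto (fun x : ℝ => 1 - x) (𝓝 1) (𝓝 (1 - 1)) := by
      exact tendsto_const_nhds.sub tendsto_id
    rw [sub_self] at this
    exact this.mono_left nhdsWithin_le_nhds
  · filter_upwards [self_mem_nhdsWithin] with x hx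
    exact sub_pos.2 (mem_Iio.1 hx)

/-- Each term is a difference of consecutive partial sums, hence `O(n)`, and `∑ n x^n` converges. -/
theorem summable_mul_pow_of_partialSums_isBigO {b : ℕ → ℝ}
    (hb : (fun n => ∑ i ∈ Finset.range n, b i) =O[atTop] fun n : ℕ => (n : ℝ))
    {x : ℝ} (hx : x ∈ Ioo (0 : ℝ) 1) : Summable fun i : ℕ => b i * x ^ (i + 1) := by
  have hnx : ‖x‖ < 1 := by rw [Real.norm_eq_abs, abs_of_pos hx.1]; exact hx.2
  have h1 : (fun n => ∑ i ∈ Finset.range (n + 1), b i) =O[atTop] fun n : ℕ => (n : ℝ) := by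
    refine (hb.comp_tendsto (tendsto_add_atTop_nat 1)).trans ?_
    refine IsBigO.of_bound 2 ?_
    filter_upwards [eventually_ge_atTop 1] with n hn
    have : (1 : ℝ) ≤ n := by exact_mod_cast hn
    simp only [Function.comp, Nat.cast_add, Nat.cast_one, Real.norm_eq_abs]
    rw [abs_of_nonneg (by positivity), abs_of_nonneg (by positivity)]
    linarith
  have h2 : b =O[atTop] fun n : ℕ => (n : ℝ) := by
    refine (h1.sub hb).congr_left fun n => ?_
    simp [Finset.sum_range_succ]
  have h3 := summable_pow_mul_geometric_of_norm_lt_one 1 hnx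
  refine summable_of_isBigO_nat (h3.mul_right x) ?_
  simpa [pow_succ, mul_assoc] using h2.mul (isBigO_refl (fun i : ℕ => x ^ (i + 1)) atTop)

/-- Comparing with harmonic sums rather than with `log` avoids estimating `∫ e^(-ht) log t dt`:
their transform is known exactly. -/
theorem isLittleO_powerSeries_of_partialSums {b : ℕ → ℝ}
    (hb : (fun n => ∑ i ∈ Finset.range n, b i) =o[atTop] fun n : ℕ => Real.log n) :
    (∀ x ∈ Ioo (0 : ℝ) 1, Summable fun i : ℕ => b i * x ^ (i + 1)) ∧
    (fun x : ℝ => ∑' i : ℕ, b i * x ^ (i + 1)) =o[𝓝[<] 1] fun x => -Real.log (1 - x) := by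
  have hs : ∀ x ∈ Ioo (0 : ℝ) 1, Summable fun i : ℕ => b i * x ^ (i + 1) := by
    intro x hx
    refine summable_mul_pow_of_partialSums_isBigO (hb.isBigO.trans ?_) hx
    exact (Real.isLittleO_log_id_atTop.isBigO).comp_tendsto tendsto_natCast_atTop_atTop
  refine ⟨hs, isLittleO_iff.2 fun ε hε => ?_⟩
  set H : ℕ → ℝ := fun i => 1 / ((i : ℝ) + 1) with hH
  have hHlog : ∀ n : ℕ, Real.log n ≤ ∑ i ∈ Finset.range n, H i := by
    intro n
    have h1 := log_add_one_le_harmonic n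
    have h2 : ((harmonic n : ℚ) : ℝ) = ∑ i ∈ Finset.range n, H i := by
      simp [harmonic, hH]
    rcases Nat.eq_zero_or_pos n with rfl | hn
    · simp
    · rw [← h2]
      refine le_trans (Real.log_le_log (by exact_mod_cast hn) ?_) h1
      push_cast; linarith
  have hHser : ∀ x ∈ Ioo (0 : ℝ) 1,
      HasSum (fun i : ℕ => H i * x ^ (i + 1)) (-Real.log (1 - x)) := by
    intro x hx
    have := Real.hasSum_pow_div_log_of_abs_lt_one (x := x) (by
      rw [abs_of_pos hx.1]; exact hx.2)
    simpa [hH, div_eq_mul_inv, mul_comm] using this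
  obtain ⟨C, hC0, hC⟩ : ∃ C, 0 ≤ C ∧ ∀ n, |∑ i ∈ Finset.range n, b i| ≤
      C + ε / 2 * ∑ i ∈ Finset.range n, H i := by
    obtain ⟨N, hN⟩ := eventually_atTop.1 (isLittleO_iff.1 hb (half_pos hε))
    -- The sum of the first `N` absolute partial sums is a crude bound for each of them.
    refine ⟨∑ n ∈ Finset.range N, |∑ i ∈ Finset.range n, b i|,
      Finset.sum_nonneg fun _ _ => abs_nonneg _, fun n => ?_⟩
    have hHn : 0 ≤ ∑ i ∈ Finset.range n, H i :=
      Finset.sum_nonneg fun i _ => by simp only [hH]; positivity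
    by_cases hn : n < N
    · have := Finset.single_le_sum (f := fun n => |∑ i ∈ Finset.range n, b i|)
        (fun _ _ => abs_nonneg _) (Finset.mem_range.2 hn)
      have h2 : 0 ≤ ε / 2 * ∑ i ∈ Finset.range n, H i := by positivity
      linarith
    · have h1 := hN n (not_lt.1 hn)
      have h3 : (0 : ℝ) ≤ ∑ n ∈ Finset.range N, |∑ i ∈ Finset.range n, b i| :=
        Finset.sum_nonneg fun _ _ => abs_nonneg _
      rw [Real.norm_eq_abs, Real.norm_eq_abs, abs_of_nonneg (Real.log_natCast_nonneg n)] at h1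
      have := mul_le_mul_of_nonneg_left (hHlog n) (half_pos hε).le
      linarith
  have hmain : ∀ x ∈ Ioo (0 : ℝ) 1,
      |∑' i : ℕ, b i * x ^ (i + 1)| ≤ C + ε / 2 * -Real.log (1 - x) := by
    intro x hx
    have hh : 0 < -Real.log x := neg_pos.2 (Real.log_neg hx.1 hx.2)
    have hexp : Real.exp (-(-Real.log x)) = x := by rw [neg_neg, Real.exp_log hx.1]
    obtain ⟨i1, e1⟩ := laplace_stepSum (a := b) hh (by rw [hexp]; exact hs x hx)
    obtain ⟨i2, e2⟩ := laplace_stepSum (a := H) hh (by rw [hexp]; exact (hHser x hx).summable)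
    rw [hexp] at e1 e2
    rw [(hHser x hx).tsum_eq] at e2
    set h := -Real.log x
    have i0 : IntegrableOn (fun t => Real.exp (-h * t)) (Ioi 0) :=
      integrableOn_exp_mul_Ioi (neg_lt_zero.2 hh) _
    have e0 : ∫ t in Ioi 0, Real.exp (-h * t) = 1 / h := by
      rw [integral_exp_mul_Ioi (neg_lt_zero.2 hh)]
      simp [neg_div_neg_eq]
    have hle : ‖∫ t in Ioi 0, Real.exp (-h * t) * stepSum b t‖ ≤
        ∫ t in Ioi 0, (C * Real.exp (-h * t) + ε / 2 * (Real.exp (-h * t) * stepSum H t)) := by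
      refine norm_integral_le_of_norm_le ((i0.const_mul C).add (i2.const_mul _))
        (Eventually.of_forall fun t => ?_)
      rw [norm_mul, Real.norm_eq_abs, Real.norm_eq_abs, Real.abs_exp]
      have := mul_le_mul_of_nonneg_left (hC ⌊t⌋₊) (Real.exp_pos (-h * t)).le
      simp only [stepSum]
      linarith
    rw [integral_add (i0.const_mul C) (i2.const_mul _), integral_const_mul, integral_const_mul,
      e0, e1, e2, norm_mul, Real.norm_eq_abs, Real.norm_eq_abs,
      abs_of_pos (one_div_pos.2 hh)] at hle
    have := mul_le_mul_of_nonneg_left hle hh.le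
    field_simp at this ⊢
    linarith
  filter_upwards [tendsto_neg_log_one_sub.eventually_ge_atTop (2 * C / ε),
    Ioo_mem_nhdsLT (zero_lt_one' ℝ)] with x hx1 hx
  have h1 := hmain x hx
  have h2 : 0 ≤ -Real.log (1 - x) := le_trans (by positivity) hx1
  rw [Real.norm_eq_abs, Real.norm_eq_abs, abs_of_nonneg h2]
  rw [div_le_iff₀ hε] at hx1
  linarith

/-! ### Slow decrease across arbitrary scale ratios -/

/-- The passage from `x` to `y` takes at most `⌈log (y/x) / log lam⌉` steps of ratio at most `lam`,
each costing at most `K log y`. The induction peels off the last step, from `y / lam` to `y`. -/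
theorem chain_lower_bound {A : ℝ → ℝ} {K lam T : ℝ} (hK : 0 ≤ K) (hlam : 1 < lam) (hT : 1 ≤ T)
    (h : ∀ x ≥ T, ∀ y, x ≤ y → y ≤ lam * x → -(K * Real.log x) ≤ A y - A x)
    {x y : ℝ} (hx : T ≤ x) (hxy : x ≤ y) :
    -(K * Real.log y * (1 + Real.log (y / x) / Real.log lam)) ≤ A y - A x := by
  have hlam0 : 0 < lam := by linarith
  have hx0 : 0 < x := by linarith
  have step : ∀ n : ℕ, ∀ y, x ≤ y → y ≤ lam ^ n * x → -(n * (K * Real.log y)) ≤ A y - A x := by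
    intro n
    induction n with
    | zero =>
      intro y h1 h2
      have : y = x := le_antisymm (by simpa using h2) h1
      simp [this]
    | succ n ih =>
      intro y h1 h2
      have hy0 : 0 < y := by linarith
      have hlogy : 0 ≤ K * Real.log y := mul_nonneg hK (Real.log_nonneg (by linarith))
      push_cast
      by_cases hc : y ≤ lam * x
      · have h3 := h x hx y h1 hc
        have h4 : K * Real.log x ≤ K * Real.log y :=
          mul_le_mul_of_nonneg_left (Real.log_le_log hx0 h1) hK
        have h5 : 0 ≤ n * (K * Real.log y) := by positivity
        linarith
      · have h6 : x ≤ y / lam := (le_div_iff₀ hlam0).2 (by linarith)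
        have h7 := ih (y / lam) h6 ((div_le_iff₀ hlam0).2 (by rw [pow_succ] at h2; linarith))
        have h8 := h (y / lam) (hx.trans h6) y (div_le_self hy0.le hlam.le)
          (by rw [mul_div_cancel₀ _ hlam0.ne'])
        have h9 : K * Real.log (y / lam) ≤ K * Real.log y :=
          mul_le_mul_of_nonneg_left (Real.log_le_log (by positivity) (div_le_self hy0.le hlam.le))
            hK
        have h10 : n * (K * Real.log (y / lam)) ≤ n * (K * Real.log y) :=
          mul_le_mul_of_nonneg_left h9 n.cast_nonneg
        linarith
  have hll : 0 < Real.log lam := Real.log_pos hlam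
  have hr : 0 ≤ Real.log (y / x) / Real.log lam :=
    div_nonneg (Real.log_nonneg ((one_le_div hx0).2 hxy)) hll.le
  set n := ⌈Real.log (y / x) / Real.log lam⌉₊ with hn
  have hn1 : Real.log (y / x) / Real.log lam ≤ n := Nat.le_ceil _
  have hn2 : (n : ℝ) ≤ 1 + Real.log (y / x) / Real.log lam := by
    linarith [Nat.ceil_lt_add_one hr]
  have hpow : y ≤ lam ^ n * x := by
    rw [div_le_iff₀ hll, ← Real.log_pow] at hn1
    rw [← div_le_iff₀ hx0]
    exact (Real.log_le_log_iff (div_pos (by linarith) hx0) (by positivity)).1 hn1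
  have h1 := step n y hxy hpow
  have h2 := mul_le_mul_of_nonneg_right hn2
    (mul_nonneg hK (Real.log_nonneg (by linarith : (1 : ℝ) ≤ y)))
  linarith

/-- The weight controlling `A (u * v)` in terms of the scale ratio `v`. -/
noncomputable def logWeight (v : ℝ) : ℝ := (1 + |Real.log v|) ^ 2

theorem one_le_logWeight (v : ℝ) : 1 ≤ logWeight v := by
  have := abs_nonneg (Real.log v)
  unfold logWeight
  nlinarith

theorem measurable_logWeight : Measurable logWeight := by
  unfold logWeight
  exact ((Real.measurable_log.abs).const_add 1).pow_const 2

/-- From `|log v| ≤ 4 v^(1/4) + 4 v^(-1/4)` the weight is at most `3 + 48 v^(1/2) + 48 v^(-1/2)`,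
which leaves Gamma integrals at `1`, `3/2` and `1/2`. -/
theorem integrableOn_exp_mul_logWeight :
    IntegrableOn (fun v => Real.exp (-v) * logWeight v) (Ioi 0) := by
  have g1 := Real.GammaIntegral_convergent (s := 1) one_pos
  have g2 := Real.GammaIntegral_convergent (s := 3 / 2) (by norm_num)
  have g3 := Real.GammaIntegral_convergent (s := 1 / 2) (by norm_num)
  refine Integrable.mono' (((g1.const_mul 3).add (g2.const_mul 48)).add (g3.const_mul 48)) ?_ ?_
  · exact ((by fun_prop : Measurable fun v : ℝ => Real.exp (-v)).mul
      measurable_logWeight).aestronglyMeasurable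
  · filter_upwards [ae_restrict_mem measurableSet_Ioi] with v hv
    have hv : 0 < v := hv
    have hl : |Real.log v| ≤ 4 * v ^ (1 / 4 : ℝ) + 4 * v ^ (-1 / 4 : ℝ) := by
      have h1 := Real.log_le_rpow_div hv.le (show (0 : ℝ) < 1 / 4 by norm_num)
      have h2 := Real.log_le_rpow_div (inv_pos.2 hv).le (show (0 : ℝ) < 1 / 4 by norm_num)
      rw [Real.log_inv, Real.inv_rpow hv.le, ← Real.rpow_neg hv.le] at h2
      have h3 : 0 < v ^ (1 / 4 : ℝ) := Real.rpow_pos_of_pos hv _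
      have h4 : 0 < v ^ (-1 / 4 : ℝ) := Real.rpow_pos_of_pos hv _
      rw [show -(1 / 4 : ℝ) = -1 / 4 by norm_num] at h2
      rw [abs_le]
      constructor <;> linarith
    have s1 : v ^ (3 / 2 - 1 : ℝ) = (v ^ (1 / 4 : ℝ)) ^ 2 := by
      rw [← Real.rpow_mul_natCast hv.le]; norm_num
    have s2 : v ^ (1 / 2 - 1 : ℝ) = (v ^ (-1 / 4 : ℝ)) ^ 2 := by
      rw [← Real.rpow_mul_natCast hv.le]; norm_num
    have s0 : v ^ (1 - 1 : ℝ) = 1 := by simp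
    simp only [Pi.add_apply, s1, s2, s0]
    rw [norm_mul, Real.norm_eq_abs, Real.abs_exp, Real.norm_eq_abs,
      abs_of_nonneg (by linarith [one_le_logWeight v])]
    have hw : logWeight v ≤ 3 + 48 * (v ^ (1 / 4 : ℝ)) ^ 2 + 48 * (v ^ (-1 / 4 : ℝ)) ^ 2 := by
      unfold logWeight
      set p := v ^ (1 / 4 : ℝ)
      set r := v ^ (-1 / 4 : ℝ)
      have h0 := abs_nonneg (Real.log v)
      have : (1 + |Real.log v|) ^ 2 ≤ (1 + (4 * p + 4 * r)) ^ 2 :=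
        pow_le_pow_left₀ (by linarith) (by linarith) 2
      nlinarith [sq_nonneg (1 - 4 * p), sq_nonneg (1 - 4 * r), sq_nonneg (4 * p - 4 * r)]
    have := mul_le_mul_of_nonneg_left hw (Real.exp_pos (-v)).le
    linarith

/-- The weight is a square because the chain bound for `v ≥ 1` is a product of two factors linear in
`log v`: the size `log (u * v)` and the number of steps. -/
theorem scale_lower_bound {A : ℝ → ℝ} {K lam T : ℝ} (hK : 0 ≤ K) (hlam : 1 < lam)
    (hbdd : ∀ T, ∃ M, ∀ t ∈ Icc 0 T, |A t| ≤ M)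
    (h : ∀ x ≥ T, ∀ y, x ≤ y → y ≤ lam * x → -(K * Real.log x) ≤ A y - A x) :
    ∃ C U : ℝ, 0 ≤ C ∧ Real.exp 1 ≤ U ∧ ∀ u ≥ U, ∀ v > 0,
      (1 ≤ v → -(C * Real.log u * logWeight v) ≤ A (u * v) - A u) ∧
      (v ≤ 1 → -(C * Real.log u * logWeight v) ≤ A u - A (u * v)) := by
  set S := max T (Real.exp 1) with hS
  have hS1 : Real.exp 1 ≤ S := le_max_right _ _
  have he : (1 : ℝ) ≤ Real.exp 1 := Real.one_le_exp zero_le_one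
  have chain := fun {x y : ℝ} => chain_lower_bound (A := A) hK hlam (he.trans hS1)
    (fun x hx => h x ((le_max_left _ _).trans hx)) (x := x) (y := y)
  have hll : 0 < Real.log lam := Real.log_pos hlam
  obtain ⟨M, hM⟩ := hbdd S
  have hM0 : 0 ≤ M := (abs_nonneg _).trans (hM 0 ⟨le_rfl, by linarith⟩)
  set c := 1 / Real.log lam with hc
  have hc0 : 0 ≤ c := by positivity
  refine ⟨K * (1 + c) + 2 * M, S, by positivity, hS1, fun u hu v hv => ?_⟩
  have hu0 : 0 < u := by linarith
  have hlu : 1 ≤ Real.log u := by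
    rw [Real.le_log_iff_exp_le hu0]; linarith
  have hW : 2 * M ≤ 2 * M * Real.log u * logWeight v := by
    have h1 := one_le_logWeight v
    have h2 : 1 ≤ Real.log u * logWeight v := one_le_mul_of_one_le_of_one_le hlu h1
    have := mul_le_mul_of_nonneg_left h2 (by positivity : 0 ≤ 2 * M)
    linarith
  constructor
  · intro hv1
    have h1 := chain (x := u) (y := u * v) hu (le_mul_of_one_le_right hu0.le hv1)
    rw [mul_div_cancel_left₀ _ hu0.ne', Real.log_mul hu0.ne' hv.ne'] at h1
    have hlv : 0 ≤ Real.log v := Real.log_nonneg hv1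
    unfold logWeight at hW ⊢
    rw [abs_of_nonneg hlv] at hW ⊢
    set l := Real.log v
    have h2 : (Real.log u + l) * (1 + l / Real.log lam) ≤
        (Real.log u * (1 + l)) * ((1 + c) * (1 + l)) := by
      apply mul_le_mul
      · nlinarith
      · rw [div_eq_mul_one_div, ← hc]; nlinarith
      · positivity
      · positivity
    have h3 := mul_le_mul_of_nonneg_left h2 hK
    nlinarith
  · intro hv1
    have hlv : Real.log v ≤ 0 := Real.log_nonpos hv.le hv1
    -- The inequality `r ≤ -log v` serves both starting points below: `u * v` itself, and the
    -- threshold `S` when `u * v < S`.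
    have key : ∀ r, r ≤ -Real.log v → K * Real.log u * (1 + r / Real.log lam) ≤
        K * (1 + c) * Real.log u * logWeight v := by
      intro r hr
      unfold logWeight
      rw [abs_of_nonpos hlv]
      set l := -Real.log v
      have hl : 0 ≤ l := neg_nonneg.2 hlv
      have h2 : 1 + r / Real.log lam ≤ (1 + c) * (1 + l) ^ 2 := by
        rw [div_eq_mul_one_div, ← hc]
        have := mul_le_mul_of_nonneg_right hr hc0
        nlinarith [mul_nonneg hc0 hl, mul_nonneg hc0 (sq_nonneg l)]
      have := mul_le_mul_of_nonneg_left h2 (mul_nonneg hK (by linarith : 0 ≤ Real.log u))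
      linarith
    have huv : u * v ≤ u := mul_le_of_le_one_right hu0.le hv1
    by_cases hc : S ≤ u * v
    · have h1 := chain hc huv
      have h2 := key (Real.log (u / (u * v))) (by
        rw [div_mul_cancel_left₀ hu0.ne', Real.log_inv])
      nlinarith
    -- Slow decrease is unknown below `S`, so the chain starts at `S`; the gap between `S` and `u *
    -- v` costs `2 * M`, absorbed by `hW`.
    · push Not at hc
      have h1 := chain le_rfl hu
      have h2 := key (Real.log (u / S)) (by
        rw [← Real.log_inv]
        refine Real.log_le_log (by positivity) ?_
        rw [div_le_iff₀ (by positivity), inv_mul_eq_div, le_div_iff₀ hv]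
        exact hc.le)
      have h3 := abs_le.1 (hM S ⟨by linarith, le_rfl⟩)
      have h4 := abs_le.1 (hM (u * v) ⟨by positivity, hc.le⟩)
      nlinarith

/-! ### From one-sided to two-sided bounds -/

theorem integrableOn_exp_neg_mul {k : ℝ} (hk : 0 < k) :
    IntegrableOn (fun v => Real.exp (-k * v)) (Ioi 0) :=
  integrableOn_exp_mul_Ioi (neg_lt_zero.2 hk) _

theorem integral_exp_neg_mul {k : ℝ} (hk : 0 < k) :
    ∫ v in Ioi 0, Real.exp (-k * v) = 1 / k := by
  rw [integral_exp_mul_Ioi (neg_lt_zero.2 hk)]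
  simp [neg_div_neg_eq]

theorem setIntegral_pos_of_pos_on_Ioo {f : ℝ → ℝ} {s : Set ℝ} {a b : ℝ} (hs : MeasurableSet s)
    (hab : a < b)
    (hf : ∀ v ∈ s, 0 ≤ f v) (hi : IntegrableOn f s) (hsub : Ioo a b ⊆ s)
    (hpos : ∀ v ∈ Ioo a b, 0 < f v) : 0 < ∫ v in s, f v := by
  rw [setIntegral_pos_iff_support_of_nonneg_ae _ hi]
  · have h1 : Ioo a b ⊆ Function.support f ∩ s := fun v hv => ⟨(hpos v hv).ne', hsub hv⟩
    refine lt_of_lt_of_le ?_ (measure_mono h1)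
    simpa using hab
  · filter_upwards [ae_restrict_mem hs] with v hv using hf v hv

/-- A function whose Laplace means are `o(log)` and which is one-sidedly slowly varying on the
scale of `log` satisfies a matching upper bound. -/
theorem exists_upper_oscillation_bound {A : ℝ → ℝ} {C U : ℝ}
    (hint : ∀ k > 0, ∀ u > 0, IntegrableOn (fun v => Real.exp (-k * v) * A (u * v)) (Ioi 0))
    (hlim : ∀ k : ℝ, k = 1 ∨ k = 2 →
      (fun u => ∫ v in Ioi 0, Real.exp (-k * v) * A (u * v)) =o[atTop] Real.log)
    (hC : 0 ≤ C) (hU : Real.exp 1 ≤ U)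
    (h : ∀ u ≥ U, ∀ v > 0,
      (1 ≤ v → -(C * Real.log u * logWeight v) ≤ A (u * v) - A u) ∧
      (v ≤ 1 → -(C * Real.log u * logWeight v) ≤ A u - A (u * v))) :
    ∃ K rho T : ℝ, 0 ≤ K ∧ 1 < rho ∧ ∀ x ≥ T, ∀ y, x ≤ y → y ≤ rho * x →
      A y - A x ≤ K * Real.log x := by
  set c := Real.log 2 with hc
  have hc1 : c < 1 := by have := Real.log_two_lt_d9; linarith
  have hc2 : 1 / 2 < c := by have := Real.log_two_gt_d9; linarith
  have hc0 : 0 < c := by linarith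
  have hec : Real.exp (-c) = 1 / 2 := by
    rw [Real.exp_neg, hc, Real.exp_log two_pos]; norm_num
  have he : (2 : ℝ) ≤ Real.exp 1 := by linarith [Real.add_one_le_exp (1 : ℝ)]
  -- This kernel has integral `0` and changes sign only at `c = log 2 < 1`, from negative to
  -- positive.
  set q : ℝ → ℝ := fun v => Real.exp (-1 * v) - 2 * Real.exp (-2 * v) with hq
  have hq' : ∀ v, q v = Real.exp (-v) * (1 - 2 * Real.exp (-v)) := by
    intro v
    have : Real.exp (-2 * v) = Real.exp (-v) * Real.exp (-v) := by
      rw [← Real.exp_add]; congr 1; ring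
    simp only [hq, this, neg_one_mul]; ring
  have hqpos : ∀ v, c ≤ v → 0 ≤ q v := by
    intro v hv
    rw [hq']
    have : Real.exp (-v) ≤ 1 / 2 := hec ▸ Real.exp_le_exp.2 (by linarith)
    exact mul_nonneg (Real.exp_pos _).le (by linarith)
  have hqspos : ∀ v, c < v → 0 < q v := by
    intro v hv
    rw [hq']
    have : Real.exp (-v) < 1 / 2 := hec ▸ Real.exp_lt_exp.2 (by linarith)
    exact mul_pos (Real.exp_pos _) (by linarith)
  have hqneg : ∀ v, v ≤ c → q v ≤ 0 := by
    intro v hv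
    rw [hq']
    have : 1 / 2 ≤ Real.exp (-v) := hec ▸ Real.exp_le_exp.2 (by linarith)
    exact mul_nonpos_of_nonneg_of_nonpos (Real.exp_pos _).le (by linarith)
  have hqabs : ∀ v, 0 < v → |q v| ≤ Real.exp (-v) := by
    intro v hv
    rw [hq', abs_mul, Real.abs_exp]
    have h1 : Real.exp (-v) ≤ 1 := Real.exp_le_one_iff.2 (by linarith)
    have h2 := Real.exp_pos (-v)
    exact mul_le_of_le_one_right h2.le (abs_le.2 ⟨by linarith, by linarith⟩)
  have hqint : IntegrableOn q (Ioi 0) :=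
    (integrableOn_exp_neg_mul one_pos).sub ((integrableOn_exp_neg_mul two_pos).const_mul 2)
  have hq0 : ∫ v in Ioi 0, q v = 0 := by
    simp only [hq]
    rw [integral_sub (integrableOn_exp_neg_mul one_pos)
      ((integrableOn_exp_neg_mul two_pos).const_mul 2), integral_const_mul,
      integral_exp_neg_mul one_pos, integral_exp_neg_mul two_pos]
    norm_num
  have hqm : 0 < ∫ v in Ioc 1 2, q v := by
    refine setIntegral_pos_of_pos_on_Ioo (a := 1) (b := 2) measurableSet_Ioc (by norm_num)
      (fun v hv => hqpos v (by linarith [hv.1]))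
      (hqint.mono_set fun v hv => lt_trans one_pos hv.1) Ioo_subset_Ioc_self
      (fun v hv => hqspos v (by linarith [hv.1]))
  set m := ∫ v in Ioc 1 2, q v with hm
  have hqA : (fun u => ∫ v in Ioi 0, q v * A (u * v)) =o[atTop] Real.log := by
    refine ((hlim 1 (Or.inl rfl)).sub ((hlim 2 (Or.inr rfl)).const_mul_left 2)).congr' ?_
      EventuallyEq.rfl
    filter_upwards [eventually_gt_atTop 0] with u hu
    rw [← integral_const_mul, ← integral_sub (hint 1 one_pos u hu)
      ((hint 2 two_pos u hu).const_mul 2)]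
    refine integral_congr_ae (Eventually.of_forall fun v => ?_)
    simp only [hq]; ring
  obtain ⟨V, hV⟩ := eventually_atTop.1 (isLittleO_iff.1 hqA one_pos)
  set IW := ∫ v in Ioi 0, Real.exp (-v) * logWeight v with hIW
  have hIW0 : 0 ≤ IW := setIntegral_nonneg measurableSet_Ioi fun v _ =>
    mul_nonneg (Real.exp_pos _).le (zero_le_one.trans (one_le_logWeight v))
  set R := C * (1 + |Real.log c|) ^ 2 with hR
  have hR0 : 0 ≤ R := by positivity
  set J := R + 2 * C with hJ
  have hJ0 : 0 ≤ J := by positivity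
  set K := (2 + J * IW) / m with hK
  have hK0 : 0 ≤ K := by positivity
  have hwc : ∀ v > 0, logWeight (v / c) ≤ (1 + |Real.log c|) ^ 2 * logWeight v := by
    intro v hv
    unfold logWeight
    rw [← mul_pow]
    refine pow_le_pow_left₀ (by positivity) ?_ 2
    rw [Real.log_div hv.ne' hc0.ne']
    have h1 := abs_sub (Real.log v) (Real.log c)
    nlinarith [abs_nonneg (Real.log v), abs_nonneg (Real.log c)]
  have hstep : ∀ x ≥ max U V, A (1 / c * x) - A x ≤ K * Real.log x := by
    intro x hx
    have hxU : U ≤ x := (le_max_left _ _).trans hx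
    have hx0 : 0 < x := by linarith
    have hlx : 1 ≤ Real.log x := by rw [Real.le_log_iff_exp_le hx0]; linarith
    -- With this `u` the sign change `v = c` corresponds to the argument `u * v = x`. On either side
    -- the one-sided bound on `A (u * v) - A x` then has the direction matching the sign of `q`,
    -- giving `hD`.
    set u := 1 / c * x with hu
    have hxu : x ≤ u := le_mul_of_one_le_left hx0.le ((one_le_div hc0).2 hc1.le)
    have hu0 : 0 < u := by linarith
    have hlu : Real.log u ≤ 2 * Real.log x := by
      rw [← Nat.cast_ofNat, ← Real.log_pow]
      refine Real.log_le_log hu0 ?_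
      have : 1 / c ≤ x := by
        rw [div_le_iff₀ hc0]; nlinarith
      rw [hu, pow_two]
      exact mul_le_mul_of_nonneg_right this hx0.le
    have hlu0 : 0 ≤ Real.log u := Real.log_nonneg (by linarith)
    have hD : ∀ v > 0, -(R * Real.log x * (Real.exp (-v) * logWeight v)) ≤
        q v * (A (u * v) - A x) := by
      intro v hv
      have hxv : x * (v / c) = u * v := by rw [hu]; field_simp
      have h1 := h x hxU (v / c) (by positivity)
      rw [hxv] at h1
      have h2 : C * Real.log x * logWeight (v / c) ≤ R * Real.log x * logWeight v := by
        have := mul_le_mul_of_nonneg_left (hwc v hv) (by positivity : 0 ≤ C * Real.log x)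
        rw [hR]; linarith
      have h3 : 0 ≤ R * Real.log x * logWeight v :=
        mul_nonneg (by positivity) (zero_le_one.trans (one_le_logWeight v))
      have h4 := abs_le.1 (hqabs v hv)
      rcases le_total c v with hcv | hcv
      · have h5 := h1.1 ((one_le_div hc0).2 hcv)
        have h6 : -(R * Real.log x * logWeight v) ≤ A (u * v) - A x := by linarith
        have h7 := mul_le_mul_of_nonneg_left h6 (hqpos v hcv)
        have h8 := mul_le_mul_of_nonneg_right h4.2 h3
        linarith
      · have h5 := h1.2 ((div_le_one hc0).2 hcv)
        have h6 : -(R * Real.log x * logWeight v) ≤ A x - A (u * v) := by linarith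
        have h7 := mul_le_mul_of_nonneg_left h6 (neg_nonneg.2 (hqneg v hcv))
        have h8 := mul_le_mul_of_nonneg_right h4.1 h3
        linarith
    -- On `(1, 2]`, where `q > 0`, slow decrease from `u` replaces `A (u * v)` by `A u` at the extra
    -- cost `2 * C`; elsewhere `hD` alone suffices. Integration cancels the constant `A x` on the
    -- right, as `q` has mean `0`.
    have hlow : ∀ v ∈ Ioi (0 : ℝ), (Ioc 1 2).indicator (fun v => q v * (A u - A x)) v ≤
        q v * A (u * v) - q v * A x + J * Real.log x * (Real.exp (-v) * logWeight v) := by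
      intro v hv
      have hv : 0 < v := hv
      have hW0 : 0 ≤ logWeight v := zero_le_one.trans (one_le_logWeight v)
      have h2 : 0 ≤ C * Real.log x * (Real.exp (-v) * logWeight v) := by positivity
      have h1 := hD v hv
      by_cases hmem : v ∈ Ioc 1 2
      · rw [indicator_of_mem hmem]
        have h3 := (h u (hxU.trans hxu) v hv).1 hmem.1.le
        have h4 : -(C * (2 * Real.log x) * logWeight v) ≤ A (u * v) - A u := by
          have := mul_le_mul_of_nonneg_right (mul_le_mul_of_nonneg_left hlu hC) hW0
          linarith
        have h5 := mul_le_mul_of_nonneg_left h4 (hqpos v (by linarith [hmem.1]))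
        have h6 := mul_le_mul_of_nonneg_right (abs_le.1 (hqabs v hv)).2
          (by positivity : 0 ≤ C * (2 * Real.log x) * logWeight v)
        have h7 : 0 ≤ R * Real.log x * (Real.exp (-v) * logWeight v) := by positivity
        rw [hJ]
        linarith
      · rw [indicator_of_notMem hmem, hJ]
        linarith
    have i1 : IntegrableOn (fun v => q v * A (u * v)) (Ioi 0) := by
      refine ((hint 1 one_pos u hu0).sub ((hint 2 two_pos u hu0).const_mul 2)).congr
        (Eventually.of_forall fun v => ?_)
      simp only [hq, Pi.sub_apply]; ring
    have i2 : IntegrableOn (fun v => q v * A x) (Ioi 0) := hqint.mul_const _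
    have i3 : IntegrableOn (fun v => J * Real.log x * (Real.exp (-v) * logWeight v)) (Ioi 0) :=
      integrableOn_exp_mul_logWeight.const_mul _
    have hmono := setIntegral_mono_on
      ((hqint.mul_const (A u - A x)).indicator measurableSet_Ioc) ((i1.sub i2).add i3)
      measurableSet_Ioi hlow
    have e1 : ∫ v in Ioi 0, (Ioc 1 2).indicator (fun v => q v * (A u - A x)) v
        = m * (A u - A x) := by
      rw [setIntegral_indicator measurableSet_Ioc, inter_eq_right.2, integral_mul_const]
      exact fun v hv => lt_trans one_pos hv.1
    have e2 : ∫ v in Ioi 0, (q v * A (u * v) - q v * A x +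
        J * Real.log x * (Real.exp (-v) * logWeight v)) =
        (∫ v in Ioi 0, q v * A (u * v)) + J * Real.log x * IW := by
      have i12 : IntegrableOn (fun v => q v * A (u * v) - q v * A x) (Ioi 0) := i1.sub i2
      rw [integral_add i12 i3, integral_sub i1 i2, integral_mul_const, hq0,
        integral_const_mul]
      ring
    have hmono' : m * (A u - A x) ≤ (∫ v in Ioi 0, q v * A (u * v)) + J * Real.log x * IW := by
      rw [← e1, ← e2]; exact hmono
    have hVu := hV u ((le_max_right U V).trans (hx.le.trans hxu))
    rw [one_mul, Real.norm_eq_abs, Real.norm_eq_abs, abs_of_nonneg hlu0] at hVu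
    have h9 := (abs_le.1 hVu).2
    rw [hK, div_mul_eq_mul_div, le_div_iff₀ hqm]
    linarith
  have hW1 : 0 ≤ logWeight (1 / c) := zero_le_one.trans (one_le_logWeight _)
  -- To reach every `y` in `[x, x / c]`, the bound on `A (x / c) - A x` is combined with slow
  -- decrease from `y` to `x / c`.
  refine ⟨K + 2 * C * logWeight (1 / c), 1 / c, max U V, by positivity,
    (one_lt_div hc0).2 hc1, fun x hx y hxy hy => ?_⟩
  have hxU : U ≤ x := (le_max_left _ _).trans hx
  have hx0 : 0 < x := by linarith
  have hy0 : 0 < y := by linarith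
  have h1 := hstep x hx
  have hv1 : 1 ≤ 1 / c * x / y := (one_le_div hy0).2 hy
  have h2 := (h y (hxU.trans hxy) (1 / c * x / y) (by linarith)).1 hv1
  rw [mul_div_cancel₀ _ hy0.ne'] at h2
  have h3 : logWeight (1 / c * x / y) ≤ logWeight (1 / c) := by
    unfold logWeight
    have hle : 1 / c * x / y ≤ 1 / c := by
      rw [div_le_iff₀ hy0]
      exact mul_le_mul_of_nonneg_left hxy (by positivity)
    have h4 := Real.log_le_log (by linarith) hle
    have h5 := Real.log_nonneg hv1
    rw [abs_of_nonneg h5, abs_of_nonneg (h5.trans h4)]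
    exact pow_le_pow_left₀ (by linarith) (by linarith) 2
  have hly : Real.log y ≤ 2 * Real.log x := by
    rw [← Nat.cast_ofNat, ← Real.log_pow]
    refine Real.log_le_log hy0 (hy.trans ?_)
    have : 1 / c ≤ x := by
      rw [div_le_iff₀ hc0]; nlinarith
    rw [pow_two]
    exact mul_le_mul_of_nonneg_right this hx0.le
  have hly0 : 0 ≤ Real.log y := Real.log_nonneg (by linarith)
  have h6 : C * Real.log y * logWeight (1 / c * x / y) ≤ C * (2 * Real.log x) * logWeight (1 / c) :=
    mul_le_mul (mul_le_mul_of_nonneg_left hly hC) h3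
      (zero_le_one.trans (one_le_logWeight _)) (mul_nonneg hC (by linarith))
  linarith

/-- The upper oscillation bound is slow decrease of `-A`, so both signs of `A (u * v) - A u` are
controlled. Averaging against `e^(-v)`, of mass `1`, then compares `A u` with its Laplace mean. -/
theorem exists_log_bound {A : ℝ → ℝ} {K lam T : ℝ} (hK : 0 ≤ K) (hlam : 1 < lam)
    (hbdd : ∀ T, ∃ M, ∀ t ∈ Icc 0 T, |A t| ≤ M)
    (hint : ∀ k > 0, ∀ u > 0, IntegrableOn (fun v => Real.exp (-k * v) * A (u * v)) (Ioi 0))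
    (hlim : ∀ k : ℝ, k = 1 ∨ k = 2 →
      (fun u => ∫ v in Ioi 0, Real.exp (-k * v) * A (u * v)) =o[atTop] Real.log)
    (h : ∀ x ≥ T, ∀ y, x ≤ y → y ≤ lam * x → -(K * Real.log x) ≤ A y - A x) :
    ∃ C U : ℝ, 0 ≤ C ∧ Real.exp 1 ≤ U ∧ ∀ u ≥ U, ∀ v > 0,
      |A (u * v)| ≤ C * Real.log u * logWeight v := by
  obtain ⟨C₁, U₁, hC₁, hU₁, h₁⟩ := scale_lower_bound hK hlam hbdd h
  obtain ⟨K', rho, T', hK', hrho, h'⟩ := exists_upper_oscillation_bound hint hlim hC₁ hU₁ h₁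
  obtain ⟨C₂, U₂, hC₂, hU₂, h₂⟩ := scale_lower_bound (A := fun t => -A t) hK' hrho
    (fun T => (hbdd T).imp fun M hM t ht => by rw [abs_neg]; exact hM t ht)
    (fun x hx y hxy hy => by linarith [h' x hx y hxy hy])
  obtain ⟨V, hV⟩ := eventually_atTop.1 (isLittleO_iff.1 (hlim 1 (Or.inl rfl)) one_pos)
  set IW := ∫ v in Ioi 0, Real.exp (-v) * logWeight v with hIW
  have hIW0 : 0 ≤ IW := setIntegral_nonneg measurableSet_Ioi fun v _ =>
    mul_nonneg (Real.exp_pos _).le (zero_le_one.trans (one_le_logWeight v))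
  set B := C₁ + C₂ with hB
  refine ⟨B + (1 + B * IW), max U₁ (max U₂ V), by positivity, hU₁.trans (le_max_left _ _),
    fun u hu => ?_⟩
  have hu1 : U₁ ≤ u := (le_max_left _ _).trans hu
  have hu2 : U₂ ≤ u := (le_max_left _ _).trans ((le_max_right _ _).trans hu)
  have hu3 : V ≤ u := (le_max_right _ _).trans ((le_max_right _ _).trans hu)
  have he : (1 : ℝ) ≤ Real.exp 1 := Real.one_le_exp zero_le_one
  have hu0 : 0 < u := by linarith
  have hlu : 0 ≤ Real.log u := Real.log_nonneg (by linarith)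
  have hosc : ∀ v > 0, |A (u * v) - A u| ≤ B * Real.log u * logWeight v := by
    intro v hv
    have hW0 : 0 ≤ logWeight v := zero_le_one.trans (one_le_logWeight v)
    have p1 : 0 ≤ C₁ * Real.log u * logWeight v := by positivity
    have p2 : 0 ≤ C₂ * Real.log u * logWeight v := by positivity
    have a1 := h₁ u hu1 v hv
    have a2 := h₂ u hu2 v hv
    rw [abs_le, hB]
    rcases le_total 1 v with hv1 | hv1
    · have b1 := a1.1 hv1
      have b2 := a2.1 hv1
      constructor <;> linarith
    · have b1 := a1.2 hv1
      have b2 := a2.2 hv1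
      constructor <;> linarith
  have hAu : |A u| ≤ (1 + B * IW) * Real.log u := by
    have i1 := hint 1 one_pos u hu0
    have i2 : IntegrableOn (fun v => Real.exp (-1 * v) * A u) (Ioi 0) :=
      (integrableOn_exp_neg_mul one_pos).mul_const _
    have e1 : ‖∫ v in Ioi 0, (Real.exp (-1 * v) * A (u * v) - Real.exp (-1 * v) * A u)‖ ≤
        ∫ v in Ioi 0, B * Real.log u * (Real.exp (-v) * logWeight v) := by
      refine norm_integral_le_of_norm_le (integrableOn_exp_mul_logWeight.const_mul _) ?_
      filter_upwards [ae_restrict_mem measurableSet_Ioi] with v hv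
      rw [← mul_sub, norm_mul, Real.norm_eq_abs, Real.abs_exp, neg_one_mul]
      have := mul_le_mul_of_nonneg_left (hosc v hv) (Real.exp_pos (-v)).le
      rw [Real.norm_eq_abs]
      linarith
    rw [integral_sub i1 i2, integral_mul_const, integral_exp_neg_mul one_pos, integral_const_mul,
      Real.norm_eq_abs] at e1
    have e2 := hV u hu3
    rw [one_mul, Real.norm_eq_abs, Real.norm_eq_abs, abs_of_nonneg hlu] at e2
    rw [abs_le] at e1 e2 ⊢
    constructor <;> linarith [e1.1, e1.2, e2.1, e2.2]
  intro v hv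
  have h1 := hosc v hv
  have h2 : (1 + B * IW) * Real.log u * 1 ≤ (1 + B * IW) * Real.log u * logWeight v :=
    mul_le_mul_of_nonneg_left (one_le_logWeight v) (by positivity)
  have h3 := abs_sub_abs_le_abs_sub (A (u * v)) (A u)
  linarith

/-! ### Karamata's polynomial approximation -/

theorem polynomial_laplace_isLittleO {A : ℝ → ℝ}
    (hint : ∀ k > 0, ∀ u > 0, IntegrableOn (fun v => Real.exp (-k * v) * A (u * v)) (Ioi 0))
    (hlim : ∀ k : ℝ, (∃ n : ℕ, k = n + 1) →
      (fun u => ∫ v in Ioi 0, Real.exp (-k * v) * A (u * v)) =o[atTop] Real.log)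
    (P : Polynomial ℝ) :
    (∀ u > 0, IntegrableOn (fun v => Real.exp (-v) * P.eval (Real.exp (-v)) * A (u * v)) (Ioi 0)) ∧
    (fun u => ∫ v in Ioi 0, Real.exp (-v) * P.eval (Real.exp (-v)) * A (u * v))
      =o[atTop] Real.log := by
  induction P using Polynomial.induction_on' with
  | add P Q hP hQ =>
    have e : ∀ u v, Real.exp (-v) * (P + Q).eval (Real.exp (-v)) * A (u * v) =
        Real.exp (-v) * P.eval (Real.exp (-v)) * A (u * v) +
        Real.exp (-v) * Q.eval (Real.exp (-v)) * A (u * v) := by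
      intro u v; rw [Polynomial.eval_add]; ring
    simp only [e]
    refine ⟨fun u hu => (hP.1 u hu).add (hQ.1 u hu), (hP.2.add hQ.2).congr' ?_ EventuallyEq.rfl⟩
    filter_upwards [eventually_gt_atTop 0] with u hu
    rw [integral_add (hP.1 u hu) (hQ.1 u hu)]
  | monomial n c =>
    have e : ∀ u v, Real.exp (-v) * (Polynomial.monomial n c).eval (Real.exp (-v)) * A (u * v) =
        c * (Real.exp (-((n : ℝ) + 1) * v) * A (u * v)) := by
      intro u v
      have : Real.exp (-((n : ℝ) + 1) * v) = Real.exp (-v) * Real.exp (-v) ^ n := by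
        rw [← Real.exp_nat_mul, ← Real.exp_add]; congr 1; ring
      rw [Polynomial.eval_monomial, this]; ring
    simp only [e, integral_const_mul]
    exact ⟨fun u hu => (hint _ (by positivity) u hu).const_mul c,
      (hlim _ ⟨n, rfl⟩).const_mul_left c⟩

/-- By Weierstrass, `g` is uniformly close to a polynomial on `[0, 1]`; the weighted bound `hA`
makes the error a small multiple of `log u`, uniformly in `u ≥ U`. -/
theorem continuous_laplace_isLittleO {A : ℝ → ℝ} {C U : ℝ} (hC : 0 ≤ C) (hU : Real.exp 1 ≤ U)
    (hint : ∀ k > 0, ∀ u > 0, IntegrableOn (fun v => Real.exp (-k * v) * A (u * v)) (Ioi 0))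
    (hlim : ∀ k : ℝ, (∃ n : ℕ, k = n + 1) →
      (fun u => ∫ v in Ioi 0, Real.exp (-k * v) * A (u * v)) =o[atTop] Real.log)
    (hA : ∀ u ≥ U, ∀ v > 0, |A (u * v)| ≤ C * Real.log u * logWeight v)
    {g : ℝ → ℝ} (hg : Continuous g) :
    (∀ u > 0, IntegrableOn (fun v => Real.exp (-v) * g (Real.exp (-v)) * A (u * v)) (Ioi 0)) ∧
    (fun u => ∫ v in Ioi 0, Real.exp (-v) * g (Real.exp (-v)) * A (u * v))
      =o[atTop] Real.log := by
  have hmem : ∀ v ∈ Ioi (0 : ℝ), Real.exp (-v) ∈ Icc (0 : ℝ) 1 := fun v hv =>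
    ⟨(Real.exp_pos _).le, Real.exp_le_one_iff.2 (neg_nonpos.2 (le_of_lt hv))⟩
  have hi : ∀ u > 0,
      IntegrableOn (fun v => Real.exp (-v) * g (Real.exp (-v)) * A (u * v)) (Ioi 0) := by
    intro u hu
    obtain ⟨B, hB⟩ := isCompact_Icc.exists_bound_of_continuousOn (hg.continuousOn (s := Icc 0 1))
    have := (hint 1 one_pos u hu).bdd_mul (f := fun v => g (Real.exp (-v))) (c := B)
      (by fun_prop) (by
        filter_upwards [ae_restrict_mem measurableSet_Ioi] with v hv using hB _ (hmem v hv))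
    refine this.congr (Eventually.of_forall fun v => ?_)
    simp only [neg_one_mul]; ring
  refine ⟨hi, isLittleO_iff.2 fun ε hε => ?_⟩
  set IW := ∫ v in Ioi 0, Real.exp (-v) * logWeight v with hIW
  have hIW0 : 0 ≤ IW := setIntegral_nonneg measurableSet_Ioi fun v _ =>
    mul_nonneg (Real.exp_pos _).le (zero_le_one.trans (one_le_logWeight v))
  -- The approximation error is at most `δ * C * IW * log u`; the `+ 1` keeps the denominator
  -- positive.
  set δ := ε / 2 / (C * IW + 1) with hδ
  have hδ0 : 0 < δ := by positivity
  have hδ1 : δ * C * IW ≤ ε / 2 := by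
    have : δ * (C * IW + 1) = ε / 2 := by rw [hδ]; field_simp
    linarith
  obtain ⟨P, hP⟩ := exists_polynomial_near_of_continuousOn 0 1 g hg.continuousOn δ hδ0
  obtain ⟨iP, lP⟩ := polynomial_laplace_isLittleO hint hlim P
  filter_upwards [isLittleO_iff.1 lP (half_pos hε), eventually_ge_atTop U] with u h1 hu
  have he : (1 : ℝ) ≤ Real.exp 1 := Real.one_le_exp zero_le_one
  have hu0 : 0 < u := by linarith
  have hlu : 0 ≤ Real.log u := Real.log_nonneg (by linarith)
  have e1 : ‖∫ v in Ioi 0, (Real.exp (-v) * P.eval (Real.exp (-v)) * A (u * v) -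
      Real.exp (-v) * g (Real.exp (-v)) * A (u * v))‖ ≤
      ∫ v in Ioi 0, δ * C * Real.log u * (Real.exp (-v) * logWeight v) := by
    refine norm_integral_le_of_norm_le (integrableOn_exp_mul_logWeight.const_mul _) ?_
    filter_upwards [ae_restrict_mem measurableSet_Ioi] with v hv
    rw [← sub_mul, ← mul_sub, norm_mul, norm_mul, Real.norm_eq_abs, Real.abs_exp,
      Real.norm_eq_abs, Real.norm_eq_abs]
    have h2 := mul_le_mul (hP _ (hmem v hv)).le (hA u hu v hv) (abs_nonneg _) hδ0.le
    have := mul_le_mul_of_nonneg_left h2 (Real.exp_pos (-v)).le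
    linarith
  rw [integral_sub (iP u hu0) (hi u hu0), integral_const_mul, ← hIW, Real.norm_eq_abs] at e1
  rw [Real.norm_eq_abs, Real.norm_eq_abs, abs_of_nonneg hlu] at h1 ⊢
  have h3 := mul_le_mul_of_nonneg_right hδ1 hlu
  rw [abs_le] at e1 h1 ⊢
  constructor <;> linarith [e1.1, e1.2, h1.1, h1.2]

/-! ### Localisation by bumps and the Tauberian theorem -/

/-- A continuous bump: `v ↦ exp (-v) * g (exp (-v))` is nonnegative, positive on `(a, b)`, and
vanishes elsewhere. -/
theorem exists_bump {a b : ℝ} (ha : 0 < a) (hab : a < b) :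
    ∃ g : ℝ → ℝ, Continuous g ∧ (∀ x, 0 ≤ g x) ∧
      (∀ v, v ∉ Ioo a b → g (Real.exp (-v)) = 0) ∧
      IntegrableOn (fun v => Real.exp (-v) * g (Real.exp (-v))) (Ioi 0) ∧
      0 < ∫ v in Ioi 0, Real.exp (-v) * g (Real.exp (-v)) := by
  set g : ℝ → ℝ := fun x => max 0 (Real.exp (-a) - x) * max 0 (x - Real.exp (-b)) with hg
  have hc : Continuous g := by fun_prop
  have h0 : ∀ x, 0 ≤ g x := fun x => mul_nonneg (le_max_left _ _) (le_max_left _ _)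
  have hi : IntegrableOn (fun v => Real.exp (-v) * g (Real.exp (-v))) (Ioi 0) := by
    obtain ⟨B, hB⟩ := isCompact_Icc.exists_bound_of_continuousOn (hc.continuousOn (s := Icc 0 1))
    refine (integrableOn_exp_neg_Ioi 0).mul_bdd (g := fun v => g (Real.exp (-v))) (c := B)
      (by fun_prop) ?_
    filter_upwards [ae_restrict_mem measurableSet_Ioi] with v hv
    exact hB _ ⟨(Real.exp_pos _).le, Real.exp_le_one_iff.2 (neg_nonpos.2 (le_of_lt hv))⟩
  refine ⟨g, hc, h0, fun v hv => ?_, hi, ?_⟩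
  · simp only [hg]
    rcases le_or_gt v a with h | h
    · rw [max_eq_left (a := 0) (b := Real.exp (-a) - Real.exp (-v)), zero_mul]
      exact sub_nonpos.2 (Real.exp_le_exp.2 (by linarith))
    · have : b ≤ v := by
        by_contra hb
        exact hv ⟨h, not_le.1 hb⟩
      rw [max_eq_left (a := 0) (b := Real.exp (-v) - Real.exp (-b)), mul_zero]
      exact sub_nonpos.2 (Real.exp_le_exp.2 (by linarith))
  · refine setIntegral_pos_of_pos_on_Ioo measurableSet_Ioi hab
      (fun v _ => mul_nonneg (Real.exp_pos _).le (h0 _)) hi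
      (fun v hv => ha.trans hv.1) (fun v hv => mul_pos (Real.exp_pos _) (mul_pos ?_ ?_))
    · exact lt_max_of_lt_right (sub_pos.2 (Real.exp_lt_exp.2 (by linarith [hv.1])))
    · exact lt_max_of_lt_right (sub_pos.2 (Real.exp_lt_exp.2 (by linarith [hv.2])))

/-- Tauberian theorem: Laplace means of order `o(log)` and slow decrease on the scale of `log`
imply that the function itself is `o(log)`. -/
theorem isLittleO_log_of_laplace {A : ℝ → ℝ}
    (hbdd : ∀ T, ∃ M, ∀ t ∈ Icc 0 T, |A t| ≤ M)
    (hint : ∀ k > 0, ∀ u > 0, IntegrableOn (fun v => Real.exp (-k * v) * A (u * v)) (Ioi 0))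
    (hlim : ∀ k : ℝ, (∃ n : ℕ, k = n + 1) →
      (fun u => ∫ v in Ioi 0, Real.exp (-k * v) * A (u * v)) =o[atTop] Real.log)
    (hslow : ∀ ε > 0, ∃ lam T : ℝ, 1 < lam ∧
      ∀ x ≥ T, ∀ y, x ≤ y → y ≤ lam * x → -(ε * Real.log x) ≤ A y - A x) :
    A =o[atTop] Real.log := by
  obtain ⟨lam₁, T₁, hlam₁, h₁⟩ := hslow 1 one_pos
  obtain ⟨C, U, hC, hU, hA⟩ := exists_log_bound zero_le_one hlam₁ hbdd hint
    (fun k hk => hlim k (by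
      rcases hk with rfl | rfl
      · exact ⟨0, by norm_num⟩
      · exact ⟨1, by norm_num⟩)) h₁
  refine isLittleO_iff.2 fun ε hε => ?_
  obtain ⟨lam, T, hlam, h⟩ := hslow (ε / 2) (half_pos hε)
  have hlam0 : 0 < lam := by linarith
  -- Averaging to the right of `u`, over `v ∈ (1, lam)`, bounds `A u` above; averaging to the left,
  -- over `v ∈ (1/lam, 1)`, bounds it below.
  obtain ⟨g₁, hc₁, hn₁, hz₁, hi₁, hm₁⟩ := exists_bump one_pos hlam
  obtain ⟨g₂, hc₂, hn₂, hz₂, hi₂, hm₂⟩ := exists_bump (inv_pos.2 hlam0) (inv_lt_one_of_one_lt₀ hlam)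
  obtain ⟨j₁, l₁⟩ := continuous_laplace_isLittleO hC hU hint hlim hA hc₁
  obtain ⟨j₂, l₂⟩ := continuous_laplace_isLittleO hC hU hint hlim hA hc₂
  filter_upwards [isLittleO_iff.1 l₁ (mul_pos (half_pos hε) hm₁),
    isLittleO_iff.1 l₂ (mul_pos (half_pos hε) hm₂), eventually_ge_atTop T,
    eventually_ge_atTop (lam * T), eventually_ge_atTop lam] with u a₁ a₂ hT hT' hul
  have hu0 : 0 < u := by linarith
  have hlu : 0 ≤ Real.log u := Real.log_nonneg (by linarith)
  set m₁ := ∫ v in Ioi 0, Real.exp (-v) * g₁ (Real.exp (-v))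
  set m₂ := ∫ v in Ioi 0, Real.exp (-v) * g₂ (Real.exp (-v))
  rw [Real.norm_eq_abs, Real.norm_eq_abs, abs_of_nonneg hlu, abs_le] at a₁ a₂
  rw [Real.norm_eq_abs, Real.norm_eq_abs, abs_of_nonneg hlu, abs_le]
  constructor
  · have hmono := setIntegral_mono_on (j₂ u hu0)
      (hi₂.mul_const (A u + ε / 2 * Real.log u)) measurableSet_Ioi (fun v hv => by
        by_cases hv' : v ∈ Ioo lam⁻¹ 1
        · have hw0 : 0 < v := hv
          have h1 : u * v ≤ u := mul_le_of_le_one_right hu0.le hv'.2.le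
          have h2 : u ≤ lam * (u * v) := by
            have := mul_le_mul_of_nonneg_left hv'.1.le (mul_pos hlam0 hu0).le
            rw [mul_comm lam u, mul_assoc, mul_inv_cancel₀ hlam0.ne'] at this
            linarith
          have h3 := h (u * v) (by
            by_contra hcon
            have := mul_lt_mul_of_pos_left (not_le.1 hcon) hlam0
            linarith) u h1 h2
          have h4 := mul_le_mul_of_nonneg_left (Real.log_le_log (by positivity) h1) (half_pos hε).le
          exact mul_le_mul_of_nonneg_left (by linarith) (mul_nonneg (Real.exp_pos _).le (hn₂ _))
        · simp [hz₂ v hv'])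
    rw [integral_mul_const] at hmono
    have h5 : m₂ * (-(ε * Real.log u)) ≤ m₂ * A u := by
      linarith [a₂.1]
    exact le_of_mul_le_mul_left h5 hm₂
  · have hmono := setIntegral_mono_on (hi₁.mul_const (A u - ε / 2 * Real.log u)) (j₁ u hu0)
      measurableSet_Ioi (fun v hv => by
        by_cases hv' : v ∈ Ioo 1 lam
        · have h3 := h u hT (u * v) (le_mul_of_one_le_right hu0.le hv'.1.le)
            (by rw [mul_comm lam]; exact mul_le_mul_of_nonneg_left hv'.2.le hu0.le)
          exact mul_le_mul_of_nonneg_left (by linarith) (mul_nonneg (Real.exp_pos _).le (hn₁ _))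
        · simp [hz₁ v hv'])
    rw [integral_mul_const] at hmono
    have h5 : m₁ * A u ≤ m₁ * (ε * Real.log u) := by
      linarith [a₁.2]
    exact le_of_mul_le_mul_left h5 hm₁

/-! ### Power series as Laplace means -/

theorem stepSum_bounded_on_Icc (a : ℕ → ℝ) (T : ℝ) :
    ∃ M, ∀ t ∈ Icc 0 T, |stepSum a t| ≤ M := by
  refine ⟨∑ i ∈ Finset.range ⌊T⌋₊, |a i|, fun t ht => (Finset.abs_sum_le_sum_abs _ _).trans ?_⟩
  refine Finset.sum_le_sum_of_subset_of_nonneg ?_ fun _ _ _ => abs_nonneg _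
  exact Finset.range_subset_range.2 (Nat.floor_le_floor ht.2)

/-- Put `x = e^(-k/u)`. For `z = k/u ≤ 1` one has `1 - e^(-z) ≥ z/2 ≥ 1/(2u)`, so `-log (1-x) =
O(log u)`. -/
theorem laplace_stepSum_isLittleO {b : ℕ → ℝ}
    (hs : ∀ x ∈ Ioo (0 : ℝ) 1, Summable fun i : ℕ => b i * x ^ (i + 1))
    (hb : (fun x : ℝ => ∑' i : ℕ, b i * x ^ (i + 1)) =o[𝓝[<] 1] fun x => -Real.log (1 - x))
    {k : ℝ} (hk : 1 ≤ k) :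
    (fun u => ∫ v in Ioi 0, Real.exp (-k * v) * stepSum b (u * v)) =o[atTop] Real.log := by
  have hk0 : 0 < k := by linarith
  have ht : Tendsto (fun u : ℝ => Real.exp (-(k / u))) atTop (𝓝[<] 1) := by
    refine tendsto_nhdsWithin_iff.2 ⟨?_, ?_⟩
    · have : Tendsto (fun u : ℝ => Real.exp (-(k / u))) atTop (𝓝 (Real.exp (-0))) :=
        (Real.continuous_exp.tendsto _).comp (tendsto_id.const_div_atTop k).neg
      simpa using this
    · filter_upwards [eventually_gt_atTop 0] with u hu
      have : 0 < k / u := div_pos hk0 hu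
      exact Real.exp_lt_one_iff.2 (by linarith)
  have h1 := (hb.comp_tendsto ht).const_mul_left (1 / k)
  have h2 : ((fun x : ℝ => -Real.log (1 - x)) ∘ fun u : ℝ => Real.exp (-(k / u)))
      =O[atTop] Real.log := by
    refine IsBigO.of_bound 2 ?_
    filter_upwards [eventually_ge_atTop 2, eventually_ge_atTop k] with u hu huk
    have hu0 : 0 < u := by linarith
    have hz : 0 < k / u := div_pos hk0 hu0
    have hz1 : k / u ≤ 1 := (div_le_one hu0).2 huk
    set z := k / u
    have hexp : 1 / (2 * u) ≤ 1 - Real.exp (-z) := by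
      have h3 : 1 / u ≤ z := div_le_div_of_nonneg_right hk hu0.le
      have h4 : Real.exp (-z) ≤ 1 / (1 + z) := by
        rw [Real.exp_neg, ← one_div]
        exact one_div_le_one_div_of_le (by linarith) (by linarith [Real.add_one_le_exp z])
      have h5 : 1 / (1 + z) ≤ 1 - z / 2 := by
        rw [div_le_iff₀ (by linarith)]
        nlinarith
      have h6 : 1 / (2 * u) = 1 / u / 2 := by field_simp
      linarith
    have hle : -Real.log (1 - Real.exp (-z)) ≤ 2 * Real.log u := by
      have h7 := Real.log_le_log (by positivity) hexp
      rw [one_div, Real.log_inv, Real.log_mul two_ne_zero hu0.ne'] at h7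
      have h8 := Real.log_le_log two_pos hu
      linarith
    have hnn : 0 ≤ -Real.log (1 - Real.exp (-z)) := by
      refine neg_nonneg.2 (Real.log_nonpos (le_trans (by positivity) hexp) ?_)
      linarith [Real.exp_pos (-z)]
    simp only [Function.comp, Real.norm_eq_abs]
    rw [abs_of_nonneg hnn, abs_of_nonneg (Real.log_nonneg (by linarith))]
    exact hle
  refine (h1.trans_isBigO h2).congr' ?_ EventuallyEq.rfl
  filter_upwards [eventually_gt_atTop 0] with u hu
  exact (laplace_stepSum_scaled hs hk0 hu).2.symm

/-- Tauberian theorem for power series on the logarithmic scale, in the case of limit `0`. -/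
theorem partialSums_isLittleO_of_powerSeries {b : ℕ → ℝ}
    (hs : ∀ x ∈ Ioo (0 : ℝ) 1, Summable fun i : ℕ => b i * x ^ (i + 1))
    (hb : (fun x : ℝ => ∑' i : ℕ, b i * x ^ (i + 1)) =o[𝓝[<] 1] fun x => -Real.log (1 - x))
    (hslow : ∀ ε > 0, ∃ lam T : ℝ, 1 < lam ∧ ∀ x ≥ T, ∀ y, x ≤ y → y ≤ lam * x →
      -(ε * Real.log x) ≤ stepSum b y - stepSum b x) :
    (fun n => ∑ i ∈ Finset.range n, b i) =o[atTop] fun n : ℕ => Real.log n := by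
  have := (isLittleO_log_of_laplace (stepSum_bounded_on_Icc b)
    (fun k hk u hu => (laplace_stepSum_scaled hs hk hu).1)
    (fun k ⟨n, hn⟩ => laplace_stepSum_isLittleO hs hb (by
      rw [hn]; linarith [n.cast_nonneg (α := ℝ)])) hslow).comp_tendsto
    tendsto_natCast_atTop_atTop
  simpa [Function.comp_def, stepSum] using this

/-! ### Recentring at the limit -/

theorem isLittleO_log_natCast_of_isBigO_one {f : ℕ → ℝ} (hf : f =O[atTop] fun _ => (1 : ℝ)) :
    f =o[atTop] fun n : ℕ => Real.log n :=
  hf.trans_isLittleO ((isLittleO_const_left.2 (Or.inr (tendsto_norm_atTop_atTop.comp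
    (Real.tendsto_log_atTop.comp tendsto_natCast_atTop_atTop)))))

/-- The terms of the logarithmic means, recentred so that the limit becomes `0`. -/
noncomputable def centredTerm (s : ℕ → ℝ) (σ : ℝ) (i : ℕ) : ℝ := (s i - σ) / ((i : ℝ) + 1)

theorem centredTerm_eq (s : ℕ → ℝ) (σ : ℝ) (i : ℕ) :
    centredTerm s σ i = s i / ((i : ℝ) + 1) - σ * (1 / ((i : ℝ) + 1)) := by
  unfold centredTerm; ring

/-- Centring costs `σ (H_{n+1} - log n) = O(1)`, and the shift from `n` to `n + 1` is harmless
because `log (n+1) - log n → 0`. -/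
theorem summableEll_iff_isLittleO (s : ℕ → ℝ) (σ : ℝ) :
    SummableEll s σ ↔
      (fun n => ∑ i ∈ Finset.range n, centredTerm s σ i) =o[atTop] fun n : ℕ => Real.log n := by
  have hlogpos : ∀ᶠ n : ℕ in atTop, 0 < Real.log n := by
    filter_upwards [eventually_ge_atTop 2] with n hn
    exact Real.log_pos (by exact_mod_cast hn)
  have hdiff : Tendsto (fun n : ℕ => Real.log (n + 1) - Real.log n) atTop (𝓝 0) :=
    Real.tendsto_log_nat_add_one_sub_log
  have hbig : (fun n : ℕ => Real.log ((n + 1 : ℕ) : ℝ)) =O[atTop] fun n : ℕ => Real.log n := by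
    have := (isLittleO_log_natCast_of_isBigO_one (hdiff.isBigO_one ℝ)).isBigO.add
      (isBigO_refl (fun n : ℕ => Real.log n) atTop)
    simpa using this
  have hbig' : (fun n : ℕ => Real.log n) =O[atTop] fun n : ℕ => Real.log ((n + 1 : ℕ) : ℝ) := by
    refine IsBigO.of_bound 1 ?_
    filter_upwards [eventually_ge_atTop 1] with n hn
    have h1 : (1 : ℝ) ≤ n := by exact_mod_cast hn
    have h2 : Real.log n ≤ Real.log ((n + 1 : ℕ) : ℝ) :=
      Real.log_le_log (by linarith) (by push_cast; linarith)
    have h3 := Real.log_nonneg h1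
    rw [one_mul, Real.norm_eq_abs, Real.norm_eq_abs, abs_of_nonneg h3, abs_of_nonneg (h3.trans h2)]
    exact h2
  have hharm : (fun n : ℕ => σ * (∑ i ∈ Finset.range (n + 1), 1 / ((i : ℝ) + 1) - Real.log n))
      =o[atTop] fun n : ℕ => Real.log n := by
    refine (isLittleO_log_natCast_of_isBigO_one ?_).const_mul_left σ
    have h1 := (Real.tendsto_harmonic_sub_log.comp (tendsto_add_atTop_nat 1)).add hdiff
    refine (h1.isBigO_one ℝ).congr_left fun n => ?_
    simp [harmonic]
  rw [← map_add_atTop_eq_nat 1, isLittleO_map]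
  simp only [Function.comp_def]
  have h1 : SummableEll s σ ↔ (fun n : ℕ => ∑ i ∈ Finset.range (n + 1), s i / ((i : ℝ) + 1) -
      σ * Real.log n) =o[atTop] fun n : ℕ => Real.log n := by
    rw [isLittleO_iff_tendsto' (by
      filter_upwards [hlogpos] with n hn h0
      exact absurd h0 hn.ne')]
    rw [SummableEll, ← tendsto_sub_nhds_zero_iff]
    refine tendsto_congr' ?_
    filter_upwards [hlogpos] with n hn
    field_simp
  rw [h1]
  have key : ∀ n : ℕ, ∑ i ∈ Finset.range (n + 1), centredTerm s σ i =
      (∑ i ∈ Finset.range (n + 1), s i / ((i : ℝ) + 1) - σ * Real.log n) -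
      σ * (∑ i ∈ Finset.range (n + 1), 1 / ((i : ℝ) + 1) - Real.log n) := by
    intro n
    simp only [centredTerm_eq, Finset.sum_sub_distrib, ← Finset.mul_sum]
    ring
  constructor
  · intro h
    exact ((h.sub hharm).congr_left fun n => (key n).symm).trans_isBigO hbig'
  · intro h
    refine ((h.trans_isBigO hbig).add hharm).congr_left fun n => ?_
    rw [key]; ring

theorem summableL_iff_isLittleO (s : ℕ → ℝ) (σ : ℝ) :
    SummableL s σ ↔
      (∀ x ∈ Ioo (0 : ℝ) 1, Summable fun i : ℕ => centredTerm s σ i * x ^ (i + 1)) ∧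
      (fun x : ℝ => ∑' i : ℕ, centredTerm s σ i * x ^ (i + 1))
        =o[𝓝[<] 1] fun x => -Real.log (1 - x) := by
  have hH : ∀ x ∈ Ioo (0 : ℝ) 1,
      HasSum (fun i : ℕ => σ * (1 / ((i : ℝ) + 1) * x ^ (i + 1))) (σ * -Real.log (1 - x)) := by
    intro x hx
    refine HasSum.mul_left σ ?_
    have := Real.hasSum_pow_div_log_of_abs_lt_one (x := x) (by
      rw [abs_of_pos hx.1]; exact hx.2)
    simpa [div_eq_mul_inv, mul_comm] using this
  have hterm : ∀ x : ℝ, (fun i : ℕ => centredTerm s σ i * x ^ (i + 1)) = fun i : ℕ =>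
      s i / ((i : ℝ) + 1) * x ^ (i + 1) - σ * (1 / ((i : ℝ) + 1) * x ^ (i + 1)) := by
    intro x; funext i; rw [centredTerm_eq]; ring
  have hsumm : ∀ x ∈ Ioo (0 : ℝ) 1, ((Summable fun i : ℕ => s i / ((i : ℝ) + 1) * x ^ (i + 1)) ↔
      Summable fun i : ℕ => centredTerm s σ i * x ^ (i + 1)) := by
    intro x hx
    rw [hterm]
    refine ⟨fun h => h.sub (hH x hx).summable, fun h => ?_⟩
    simpa using h.add (hH x hx).summable
  rw [SummableL, forall₂_congr hsumm]
  refine and_congr_right fun hs => ?_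
  have hpos : ∀ᶠ x : ℝ in 𝓝[<] 1, 0 < -Real.log (1 - x) :=
    tendsto_neg_log_one_sub.eventually_gt_atTop 0
  rw [isLittleO_iff_tendsto' (by
      filter_upwards [hpos] with x hx h0
      exact absurd h0 hx.ne'), ← tendsto_sub_nhds_zero_iff]
  refine tendsto_congr' ?_
  filter_upwards [hpos, Ioo_mem_nhdsLT (zero_lt_one' ℝ)] with x hx hx1
  rw [hterm, ((hsumm x hx1).2 (hs x hx1)).tsum_sub (hH x hx1).summable, (hH x hx1).tsum_eq]
  generalize -Real.log (1 - x) = L at hx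
  rw [sub_div, mul_div_cancel_right₀ _ hx.ne', one_div_mul_eq_div]

/-! ### Block sums and the one-sided condition -/

/-- Centring thus changes a block by a bounded amount, negligible against `log n`. -/
theorem sum_Icc_one_div_le {n m : ℕ} {lam : ℝ} (hlam : 1 ≤ lam) (hm : (m : ℝ) ≤ lam * n) :
    ∑ i ∈ Finset.Icc n m, 1 / ((i : ℝ) + 1) ≤ lam := by
  have hn1 : (0 : ℝ) < n + 1 := by positivity
  rcases lt_or_ge m n with h | h
  · rw [Finset.Icc_eq_empty (by omega), Finset.sum_empty]; linarith
  calc ∑ i ∈ Finset.Icc n m, 1 / ((i : ℝ) + 1)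
      ≤ ∑ i ∈ Finset.Icc n m, 1 / ((n : ℝ) + 1) := by
        refine Finset.sum_le_sum fun i hi => ?_
        have : (n : ℝ) ≤ i := by exact_mod_cast (Finset.mem_Icc.1 hi).1
        exact one_div_le_one_div_of_le hn1 (by linarith)
    _ ≤ lam := by
        rw [Finset.sum_const, Nat.card_Icc, nsmul_eq_mul, mul_one_div, div_le_iff₀ hn1,
          Nat.cast_sub (by omega)]
        push_cast
        nlinarith [n.cast_nonneg (α := ℝ)]

theorem sum_Icc_one_div_nonneg (n m : ℕ) : 0 ≤ ∑ i ∈ Finset.Icc n m, 1 / ((i : ℝ) + 1) :=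
  Finset.sum_nonneg fun i _ => by positivity

/-- As `-ε < l`, the inner lower limit exceeds `-ε` for some `lam > 1`; one such ratio suffices. -/
theorem OneSidedLogCondition.exists_block_lower_bound {s : ℕ → ℝ} (h : OneSidedLogCondition s)
    {ε : ℝ} (hε : 0 < ε) :
    ∃ lam : ℝ, 1 < lam ∧ ∀ᶠ n : ℕ in atTop, ∀ m : ℕ, n ≤ m → (m : ℝ) ≤ lam * n →
      -(ε * Real.log n) ≤ ∑ i ∈ Finset.Icc n m, s i / ((i : ℝ) + 1) := by
  obtain ⟨l, hl, hl0⟩ := h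
  have hlt : ((-ε : ℝ) : EReal) < l := lt_of_lt_of_le (by exact_mod_cast neg_lt_zero.2 hε) hl0
  obtain ⟨lam, hlam, hlam1⟩ :=
    ((hl.eventually (lt_mem_nhds hlt)).and self_mem_nhdsWithin).exists
  refine ⟨lam, hlam1, ?_⟩
  filter_upwards [eventually_lt_of_lt_liminf hlam, eventually_ge_atTop 2] with n hn hn2 m hnm hm
  have hlog : 0 < Real.log n := Real.log_pos (by exact_mod_cast hn2)
  have h1 : minLogBlock s lam n ≤ ((1 / Real.log (n : ℝ) *
      ∑ i ∈ Finset.Icc n m, s i / ((i : ℝ) + 1) : ℝ) : EReal) :=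
    iInf₂_le (i := m) (show m ∈ {m : ℕ | n ≤ m ∧ (m : ℝ) ≤ lam * (n : ℝ)} from ⟨hnm, hm⟩)
  have h2 := EReal.coe_lt_coe_iff.1 (hn.trans_le h1)
  rw [one_div_mul_eq_div, lt_div_iff₀ hlog] at h2
  linarith

theorem OneSidedLogCondition.stepSum_lower_bound {s : ℕ → ℝ} (h : OneSidedLogCondition s) (σ : ℝ)
    {ε : ℝ} (hε : 0 < ε) :
    ∃ lam T : ℝ, 1 < lam ∧ ∀ x ≥ T, ∀ y, x ≤ y → y ≤ lam * x →
      -(ε * Real.log x) ≤ stepSum (centredTerm s σ) y - stepSum (centredTerm s σ) x := by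
  obtain ⟨lam, hlam, hev⟩ := h.exists_block_lower_bound (half_pos hε)
  obtain ⟨N, hN⟩ := eventually_atTop.1 hev
  obtain ⟨V, hV⟩ := eventually_atTop.1
    (Real.tendsto_log_atTop.eventually_ge_atTop (|σ| * lam / (ε / 2)))
  -- The midpoint ratio absorbs the rounding: `m + 1 ≤ y ≤ (1 + lam)/2 * x` and `x < n + 1` give `m
  -- ≤ lam * n` once `n ≥ 1`. Beyond `V` the centring cost `|σ| * lam` is at most `ε / 2 * log x`.
  refine ⟨(1 + lam) / 2, max (max N 1) V, by linarith, fun x hx y hxy hy => ?_⟩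
  have hx1 : 1 ≤ x := ((le_max_right _ _).trans (le_max_left _ _)).trans hx
  have hxN : N ≤ ⌊x⌋₊ := Nat.le_floor (((le_max_left _ _).trans (le_max_left _ _)).trans hx)
  have hlogV := hV x ((le_max_right _ _).trans hx)
  rw [div_le_iff₀ (half_pos hε)] at hlogV
  have hn1 : 1 ≤ ⌊x⌋₊ := (Nat.one_le_floor_iff x).2 hx1
  have hfl : ⌊x⌋₊ ≤ ⌊y⌋₊ := Nat.floor_le_floor hxy
  have hlx : 0 ≤ Real.log x := Real.log_nonneg hx1
  have hxn := Nat.floor_le (by linarith : 0 ≤ x)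
  have hxn' := Nat.lt_floor_add_one x
  have hyn := Nat.floor_le (by linarith : 0 ≤ y)
  have hsub : stepSum (centredTerm s σ) y - stepSum (centredTerm s σ) x =
      ∑ i ∈ Finset.Ico ⌊x⌋₊ ⌊y⌋₊, centredTerm s σ i :=
    (Finset.sum_Ico_eq_sub _ hfl).symm
  rw [hsub]
  rcases hfl.eq_or_lt with heq | hlt
  · rw [heq, Finset.Ico_self, Finset.sum_empty]
    exact neg_nonpos.2 (by positivity)
  obtain ⟨m, hm⟩ : ∃ m, ⌊y⌋₊ = m + 1 := ⟨⌊y⌋₊ - 1, by omega⟩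
  set n := ⌊x⌋₊
  rw [hm] at hyn hlt ⊢
  have hIco : Finset.Ico n (m + 1) = Finset.Icc n m := by ext i; simp
  have hnr : (1 : ℝ) ≤ n := by exact_mod_cast hn1
  have hmle : (m : ℝ) ≤ lam * n := by
    push_cast at hyn
    nlinarith
  have h1 := hN n hxN m (by omega) hmle
  have h2 : Real.log n ≤ Real.log x := Real.log_le_log (by linarith) hxn
  have h3 := mul_le_mul_of_nonneg_left h2 (half_pos hε).le
  have h4 : σ * ∑ i ∈ Finset.Icc n m, 1 / ((i : ℝ) + 1) ≤ |σ| * lam :=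
    mul_le_mul (le_abs_self σ) (sum_Icc_one_div_le hlam.le hmle) (sum_Icc_one_div_nonneg n m)
      (abs_nonneg σ)
  simp only [hIco, centredTerm_eq, Finset.sum_sub_distrib, ← Finset.mul_sum]
  linarith

theorem SummableEll.block_isLittleO {s : ℕ → ℝ} {σ : ℝ} (h : SummableEll s σ) {lam : ℝ}
    (hlam : 1 < lam) {ε : ℝ} (hε : 0 < ε) :
    ∀ᶠ n : ℕ in atTop, ∀ m : ℕ, n ≤ m → (m : ℝ) ≤ lam * n →
      |∑ i ∈ Finset.Icc n m, s i / ((i : ℝ) + 1)| ≤ ε * Real.log n := by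
  rw [summableEll_iff_isLittleO] at h
  -- The quarters: two for the partial sum up to `m`, since `log (m+1) ≤ 2 log n`, one for the
  -- partial sum below `n`, one for the centring.
  have hε4 : 0 < ε / 4 := by linarith
  obtain ⟨N, hN⟩ := eventually_atTop.1 (isLittleO_iff.1 h hε4)
  have hlogt : Tendsto (fun n : ℕ => Real.log n) atTop atTop :=
    Real.tendsto_log_atTop.comp tendsto_natCast_atTop_atTop
  filter_upwards [eventually_ge_atTop N, eventually_ge_atTop 1,
    hlogt.eventually_ge_atTop (|σ| * lam / (ε / 4)),
    hlogt.eventually_ge_atTop (Real.log (lam + 1))] with n hnN hn1 hσ hll m hnm hm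
  have hnr : (1 : ℝ) ≤ n := by exact_mod_cast hn1
  rw [div_le_iff₀ hε4] at hσ
  have h1 := hN n hnN
  have h2 := hN (m + 1) (by omega)
  rw [Real.norm_eq_abs, Real.norm_eq_abs, abs_of_nonneg (Real.log_natCast_nonneg _)] at h1 h2
  have h3 : Real.log ((m + 1 : ℕ) : ℝ) ≤ 2 * Real.log n := by
    have : Real.log ((m + 1 : ℕ) : ℝ) ≤ Real.log ((lam + 1) * n) :=
      Real.log_le_log (by positivity) (by push_cast; linarith)
    rw [Real.log_mul (by linarith) (by linarith)] at this
    linarith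
  have h4 := mul_le_mul_of_nonneg_left h3 hε4.le
  have h5 : |σ * ∑ i ∈ Finset.Icc n m, 1 / ((i : ℝ) + 1)| ≤ |σ| * lam := by
    rw [abs_mul, abs_of_nonneg (sum_Icc_one_div_nonneg n m)]
    exact mul_le_mul_of_nonneg_left (sum_Icc_one_div_le hlam.le hm) (abs_nonneg σ)
  have hIco : Finset.Ico n (m + 1) = Finset.Icc n m := by ext i; simp
  have h6 : ∑ i ∈ Finset.Icc n m, s i / ((i : ℝ) + 1) =
      ∑ i ∈ Finset.range (m + 1), centredTerm s σ i - ∑ i ∈ Finset.range n, centredTerm s σ i +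
      σ * ∑ i ∈ Finset.Icc n m, 1 / ((i : ℝ) + 1) := by
    rw [← Finset.sum_Ico_eq_sub _ (by omega : n ≤ m + 1), hIco]
    simp only [centredTerm_eq, Finset.sum_sub_distrib, ← Finset.mul_sum]
    ring
  rw [h6]
  rw [abs_le] at h1 h2 h5 ⊢
  constructor <;> linarith [h1.1, h1.2, h2.1, h2.2, h5.1, h5.2]

theorem SummableEll.tendsto_minLogBlock {s : ℕ → ℝ} {σ : ℝ} (h : SummableEll s σ) {lam : ℝ}
    (hlam : 1 < lam) : Tendsto (minLogBlock s lam) atTop (𝓝 0) := by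
  have key : ∀ ε > 0, ∀ᶠ n : ℕ in atTop, ((-ε : ℝ) : EReal) ≤ minLogBlock s lam n ∧
      minLogBlock s lam n ≤ ((ε : ℝ) : EReal) := by
    intro ε hε
    filter_upwards [h.block_isLittleO hlam hε, eventually_ge_atTop 2] with n hn hn2
    have hlog : 0 < Real.log n := Real.log_pos (by exact_mod_cast hn2)
    have hb : ∀ m : ℕ, n ≤ m → (m : ℝ) ≤ lam * n →
        |1 / Real.log n * ∑ i ∈ Finset.Icc n m, s i / ((i : ℝ) + 1)| ≤ ε := by
      intro m h1 h2
      rw [one_div_mul_eq_div, abs_div, abs_of_pos hlog, div_le_iff₀ hlog]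
      exact hn m h1 h2
    constructor
    · refine le_iInf₂ fun m hm => ?_
      exact EReal.coe_le_coe_iff.2 (abs_le.1 (hb m hm.1 hm.2)).1
    · have hmem : n ∈ {m : ℕ | n ≤ m ∧ (m : ℝ) ≤ lam * (n : ℝ)} :=
        ⟨le_rfl, le_mul_of_one_le_left n.cast_nonneg hlam.le⟩
      exact (iInf₂_le (i := n) hmem).trans
        (EReal.coe_le_coe_iff.2 (abs_le.1 (hb n hmem.1 hmem.2)).2)
  refine tendsto_order.2 ⟨fun a ha => ?_, fun a ha => ?_⟩
  · obtain ⟨r, hr1, hr2⟩ := EReal.lt_iff_exists_real_btwn.1 ha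
    have hr : r < 0 := by exact_mod_cast hr2
    filter_upwards [key (-r) (neg_pos.2 hr)] with n hn
    rw [neg_neg] at hn
    exact hr1.trans_le hn.1
  · obtain ⟨r, hr1, hr2⟩ := EReal.lt_iff_exists_real_btwn.1 ha
    have hr : 0 < r := by exact_mod_cast hr1
    filter_upwards [key r hr] with n hn
    exact hn.2.trans_lt hr2

theorem SummableEll.oneSidedLogCondition {s : ℕ → ℝ} {σ : ℝ} (h : SummableEll s σ) :
    OneSidedLogCondition s := by
  refine ⟨0, tendsto_const_nhds.congr' ?_, le_rfl⟩
  filter_upwards [self_mem_nhdsWithin] with lam hlam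
  exact (h.tendsto_minLogBlock hlam).liminf_eq.symm

/-! ### Conclusion -/

theorem SummableEll.summableL {s : ℕ → ℝ} {σ : ℝ} (h : SummableEll s σ) : SummableL s σ :=
  (summableL_iff_isLittleO s σ).2
    (isLittleO_powerSeries_of_partialSums ((summableEll_iff_isLittleO s σ).1 h))

theorem SummableL.summableEll {s : ℕ → ℝ} {σ : ℝ} (h : SummableL s σ)
    (hc : OneSidedLogCondition s) : SummableEll s σ := by
  obtain ⟨h1, h2⟩ := (summableL_iff_isLittleO s σ).1 h
  exact (summableEll_iff_isLittleO s σ).2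
    (partialSums_isLittleO_of_powerSeries h1 h2 fun ε hε => hc.stepSum_lower_bound σ hε)

theorem theorem4 (s : ℕ → ℝ) (σ : ℝ) :
    (SummableEll s σ → SummableL s σ) ∧
    (SummableEll s σ ∨ SummableL s σ →
      ((SummableEll s σ ↔ SummableL s σ) ↔ OneSidedLogCondition s)) := by
  refine ⟨SummableEll.summableL, fun h => ⟨fun hiff => ?_, fun hc => ?_⟩⟩
  -- Given one of the two methods, the equivalence amounts to having `ℓ`.
  · exact (h.elim id hiff.2).oneSidedLogCondition
  · exact ⟨SummableEll.summableL, fun hL => hL.summableEll hc⟩
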